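/- Let $D=\{z\in\mathbb C:|z|<1\}$ and let $0<\alpha<\infty$. For a continuously differentiable $f:D\to\mathbb C$ write $f_z=\frac12(f_x-if_y)$ and $f_{\bar z}=\frac12(f_x+if_y)$. The harmonic $\alpha$-Bloch space $HB(\alpha)$ consists of all complex-valued harmonic functions $f$ on $D$ with $$\sup_{z\in D}(1-|z|^2)^\alpha\bigl(|f_z(z)|+|f_{\bar z}(z)|\bigr)<\infty,$$ and carries the norm $$\|f\|_{HB(\alpha)}=|f(0)|+\sup_{z\in D}(1-|z|^2)^\alpha\bigl(|f_z(z)|+|f_{\bar z}(z)|\bigr).$$ Let $\varphi$ be analytic in $D$ with $\varphi(D)\subseteq D$, and let $C_\varphi f=f\circ\varphi$. **Theorem.** The following are equivalent. a) $C_\varphi$ maps $HB(\alpha)$ into $HB(\alpha)$ and $C_\varphi:HB(\alpha)\to HB(\alpha)$ is a compact operator. b) Both $$\sup_{z\in D}\left(\frac{1-|z|^2}{1-|\varphi(z)|^2}\right)^{\alpha}|\varphi'(z)|<\infty \qquad\text{and}\qquad \lim_{|\varphi(z)|\to1}\left(\frac{1-|z|^2}{1-|\varphi(z)|^2}\right)^{\alpha}|\varphi'(z)|=0,$$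 where the limit means that for every $\varepsilon>0$ there is $r<1$ such that $\left(\frac{1-|z|^2}{1-|\varphi(z)|^2}\right)^{\alpha}|\varphi'(z)|<\varepsilon$ for all $z\in D$ with $|\varphi(z)|>r$ (which holds vacuously if $\sup_{z \in D}|\varphi(z)|<1$). -/

import Mathlib

open Filter Topology

noncomputable section

namespace HarmonicBloch

/-- The open unit disk `D` in the complex plane. -/
abbrev disk : Set ℂ := Metric.ball (0 : ℂ) 1

/-- The centre of the disk, as a point of it. -/
def center : disk := ⟨0, by simp⟩

/-- A function on the disk, extended by `0` to the plane, so that derivatives at the points of the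
(open) disk can be taken with the usual calculus on `ℂ`; the values outside the disk are never
looked at. -/
def extend (f : disk → ℂ) : ℂ → ℂ := Function.extend Subtype.val f 0

/-- The formal derivative `f_z = (f_x - i f_y) / 2`. -/
def dz (f : ℂ → ℂ) (z : ℂ) : ℂ :=
  (1 / 2 : ℂ) * (fderiv ℝ f z 1 - Complex.I * fderiv ℝ f z Complex.I)

/-- The formal derivative `f_{z̄} = (f_x + i f_y) / 2`. -/
def dzbar (f : ℂ → ℂ) (z : ℂ) : ℂ :=
  (1 / 2 : ℂ) * (fderiv ℝ f z 1 + Complex.I * fderiv ℝ f z Complex.I)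

/-- The quantity `(1 - |z|²)^α (|f_z(z)| + |f_{z̄}(z)|)`. -/
def weighted (α : ℝ) (f : disk → ℂ) (z : disk) : ℝ :=
  (1 - ‖(z : ℂ)‖ ^ 2) ^ α * (‖dz (extend f) z‖ + ‖dzbar (extend f) z‖)

/-- Membership in the harmonic `α`-Bloch space: `f` is harmonic on the disk and
`sup_z (1 - |z|²)^α (|f_z(z)| + |f_{z̄}(z)|) < ∞`. -/
def IsHarmonicBloch (α : ℝ) (f : disk → ℂ) : Prop :=
  InnerProductSpace.HarmonicOnNhd (extend f) disk ∧ BddAbove (Set.range (weighted α f))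

theorem extend_coe (f : disk → ℂ) (z : disk) : extend f z = f z :=
  Subtype.val_injective.extend_apply f 0 z

theorem extend_zero : extend 0 = 0 := by
  funext z
  by_cases h : ∃ a : disk, (a : ℂ) = z
  · obtain ⟨a, rfl⟩ := h
    simp [extend_coe]
  · simp [extend, Function.extend_apply' _ _ _ h]

theorem extend_add (f g : disk → ℂ) : extend (f + g) = extend f + extend g := by
  funext z
  by_cases h : ∃ a : disk, (a : ℂ) = z
  · obtain ⟨a, rfl⟩ := h
    simp [extend_coe]
  · simp [extend, Function.extend_apply' _ _ _ h]

theorem extend_smul (c : ℂ) (f : disk → ℂ) : extend (c • f) = c • extend f := by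
  funext z
  by_cases h : ∃ a : disk, (a : ℂ) = z
  · obtain ⟨a, rfl⟩ := h
    simp [extend_coe]
  · simp [extend, Function.extend_apply' _ _ _ h]

theorem weight_nonneg (α : ℝ) (z : disk) : 0 ≤ (1 - ‖(z : ℂ)‖ ^ 2) ^ α := by
  have hz : ‖(z : ℂ)‖ < 1 := mem_ball_zero_iff.1 z.2
  exact Real.rpow_nonneg (by nlinarith [norm_nonneg (z : ℂ)]) α

theorem weight_pos (α : ℝ) (z : disk) : 0 < (1 - ‖(z : ℂ)‖ ^ 2) ^ α := by
  have hz : ‖(z : ℂ)‖ < 1 := mem_ball_zero_iff.1 z.2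
  exact Real.rpow_pos_of_pos (by nlinarith [norm_nonneg (z : ℂ)]) α

theorem weighted_nonneg (α : ℝ) (f : disk → ℂ) (z : disk) : 0 ≤ weighted α f z :=
  mul_nonneg (weight_nonneg α z) (by positivity)

theorem IsHarmonicBloch.differentiableAt {α : ℝ} {f : disk → ℂ} (hf : IsHarmonicBloch α f)
    (z : disk) : DifferentiableAt ℝ (extend f) z :=
  (hf.1 z z.2).1.differentiableAt (by norm_num)

theorem weighted_zero (α : ℝ) (z : disk) : weighted α 0 z = 0 := by
  simp [weighted, extend_zero, dz, dzbar]

theorem weighted_add_le {α : ℝ} {f g : disk → ℂ} (hf : IsHarmonicBloch α f)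
    (hg : IsHarmonicBloch α g) (z : disk) :
    weighted α (f + g) z ≤ weighted α f z + weighted α g z := by
  have hD := fderiv_add (hf.differentiableAt z) (hg.differentiableAt z)
  have h1 : dz (extend (f + g)) z = dz (extend f) z + dz (extend g) z := by
    simp only [dz, extend_add, hD, add_apply]; ring
  have h2 : dzbar (extend (f + g)) z = dzbar (extend f) z + dzbar (extend g) z := by
    simp only [dzbar, extend_add, hD, add_apply]; ring
  unfold weighted
  rw [h1, h2, ← mul_add]
  refine mul_le_mul_of_nonneg_left ?_ (weight_nonneg α z)
  linarith [norm_add_le (dz (extend f) z) (dz (extend g) z),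
    norm_add_le (dzbar (extend f) z) (dzbar (extend g) z)]

theorem weighted_smul {α : ℝ} (c : ℂ) (f : disk → ℂ) (hf : IsHarmonicBloch α f) (z : disk) :
    weighted α (c • f) z = ‖c‖ * weighted α f z := by
  have hD := fderiv_const_smul (hf.differentiableAt z) c
  have h1 : dz (extend (c • f)) z = c * dz (extend f) z := by
    simp only [dz, extend_smul, hD, smul_apply, smul_eq_mul]; ring
  have h2 : dzbar (extend (c • f)) z = c * dzbar (extend f) z := by
    simp only [dzbar, extend_smul, hD, smul_apply, smul_eq_mul]; ring
  unfold weighted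
  rw [h1, h2, norm_mul, norm_mul]
  ring

theorem harmonicAt_smul (c : ℂ) {f : ℂ → ℂ} {z : ℂ}
    (hf : InnerProductSpace.HarmonicAt f z) : InnerProductSpace.HarmonicAt (c • f) z := by
  have h := hf.comp_CLM (l := (c • ContinuousLinearMap.id ℝ ℂ))
  exact h

/-- The harmonic `α`-Bloch space as a set of functions on the disk, closed under the vector space
operations. -/
def submodule (α : ℝ) : Submodule ℂ (disk → ℂ) where
  carrier := {f | IsHarmonicBloch α f}
  zero_mem' := by
    refine ⟨?_, 0, ?_⟩
    · rw [extend_zero]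
      exact InnerProductSpace.harmonicOnNhd_const 0
    · rintro _ ⟨z, rfl⟩
      exact (weighted_zero α z).le
  add_mem' := by
    rintro f g hf hg
    refine ⟨?_, ?_⟩
    · rw [extend_add]
      exact fun z hz => (hf.1 z hz).add (hg.1 z hz)
    · obtain ⟨a, ha⟩ := hf.2
      obtain ⟨b, hb⟩ := hg.2
      refine ⟨a + b, ?_⟩
      rintro _ ⟨z, rfl⟩
      exact (weighted_add_le hf hg z).trans (add_le_add (ha ⟨z, rfl⟩) (hb ⟨z, rfl⟩))
  smul_mem' := by
    intro c f hf
    refine ⟨?_, ?_⟩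
    · rw [extend_smul]
      exact fun z hz => harmonicAt_smul c (hf.1 z hz)
    · obtain ⟨a, ha⟩ := hf.2
      refine ⟨‖c‖ * a, ?_⟩
      rintro _ ⟨z, rfl⟩
      rw [weighted_smul c f hf z]
      exact mul_le_mul_of_nonneg_left (ha ⟨z, rfl⟩) (norm_nonneg c)

/-- The harmonic `α`-Bloch space `HB(α)`. This is a new type, not an abbreviation, so that its
topology is the one of the Bloch norm below and not that of pointwise convergence. -/
def HB (α : ℝ) : Type := submodule α

instance (α : ℝ) : AddCommGroup (HB α) := inferInstanceAs (AddCommGroup (submodule α))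

instance (α : ℝ) : Module ℂ (HB α) := inferInstanceAs (Module ℂ (submodule α))

/-- The norm `‖f‖ = |f(0)| + sup_z (1 - |z|²)^α (|f_z(z)| + |f_{z̄}(z)|)` of `HB(α)`. -/
instance (α : ℝ) : Norm (HB α) :=
  ⟨fun f => ‖f.1 center‖ + ⨆ z : disk, weighted α f.1 z⟩

theorem norm_def (α : ℝ) (f : HB α) :
    ‖f‖ = ‖f.1 center‖ + ⨆ z : disk, weighted α f.1 z := rfl

theorem eq_zero_of_norm (α : ℝ) (f : HB α) (h : ‖f‖ = 0) : f = 0 := by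
  have hs : 0 ≤ ⨆ z : disk, weighted α f.1 z := Real.iSup_nonneg (weighted_nonneg α f.1)
  rw [norm_def] at h
  have h0 : f.1 center = 0 := norm_eq_zero.1 (by linarith [norm_nonneg (f.1 center)])
  have hsup : ⨆ z : disk, weighted α f.1 z = 0 := by linarith [norm_nonneg (f.1 center)]
  have hw : ∀ z : disk, fderiv ℝ (extend f.1) z = 0 := by
    intro z
    have hle : weighted α f.1 z ≤ 0 := hsup ▸ le_ciSup f.2.2 z
    have hsum : ‖dz (extend f.1) z‖ + ‖dzbar (extend f.1) z‖ ≤ 0 := by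
      by_contra hc
      exact absurd (mul_pos (weight_pos α z) (not_le.1 hc)) (not_lt.2 hle)
    have ha : dz (extend f.1) z = 0 := norm_eq_zero.1 (by
      linarith [norm_nonneg (dz (extend f.1) z), norm_nonneg (dzbar (extend f.1) z)])
    have hb : dzbar (extend f.1) z = 0 := norm_eq_zero.1 (by
      linarith [norm_nonneg (dz (extend f.1) z), norm_nonneg (dzbar (extend f.1) z)])
    unfold dz at ha
    unfold dzbar at hb
    have hx : fderiv ℝ (extend f.1) z 1 = 0 := by linear_combination ha + hb
    have hy : fderiv ℝ (extend f.1) z Complex.I = 0 := by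
      have : Complex.I * fderiv ℝ (extend f.1) z Complex.I = 0 := by linear_combination hb - ha
      exact (mul_eq_zero.1 this).resolve_left Complex.I_ne_zero
    refine ContinuousLinearMap.ext fun w => ?_
    have hw : w = w.re • (1 : ℂ) + w.im • Complex.I := by
      simp [Complex.re_add_im]
    rw [hw, map_add, map_smul, map_smul, hx, hy]
    simp
  refine Subtype.ext (funext fun z => ?_)
  have hc := (convex_ball (0 : ℂ) 1).is_const_of_fderivWithin_eq_zero (𝕜 := ℝ) (f := extend f.1)
    (fun w hw' => (IsHarmonicBloch.differentiableAt f.2 ⟨w, hw'⟩).differentiableWithinAt)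
    (fun w hw' => by
      rw [fderivWithin_of_isOpen Metric.isOpen_ball hw']
      exact hw ⟨w, hw'⟩) z.2 center.2
  rw [extend_coe, extend_coe, h0] at hc
  exact hc

theorem normedSpaceCore (α : ℝ) : NormedSpace.Core ℂ (HB α) where
  norm_nonneg f := add_nonneg (norm_nonneg _) (Real.iSup_nonneg (weighted_nonneg α f.1))
  norm_smul c f := by
    have h1 : (c • f).1 = c • f.1 := rfl
    rw [norm_def, norm_def, h1, mul_add, Real.mul_iSup_of_nonneg (norm_nonneg c)]
    simp only [weighted_smul c f.1 f.2, Pi.smul_apply, norm_smul]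
  norm_triangle f g := by
    have h1 : (f + g).1 = f.1 + g.1 := rfl
    have : Nonempty disk := ⟨center⟩
    have h2 : ⨆ z : disk, weighted α (f.1 + g.1) z ≤
        (⨆ z : disk, weighted α f.1 z) + ⨆ z : disk, weighted α g.1 z :=
      ciSup_le fun z => (weighted_add_le f.2 g.2 z).trans
        (add_le_add (le_ciSup f.2.2 z) (le_ciSup g.2.2 z))
    rw [norm_def, norm_def, norm_def, h1, Pi.add_apply]
    linarith [norm_add_le (f.1 center) (g.1 center)]
  norm_eq_zero_iff f := by
    refine ⟨eq_zero_of_norm α f, ?_⟩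
    rintro rfl
    have h1 : (0 : HB α).1 = 0 := rfl
    simp [norm_def, h1, weighted_zero]

instance (α : ℝ) : NormedAddCommGroup (HB α) := NormedAddCommGroup.ofCore (normedSpaceCore α)

instance (α : ℝ) : NormedSpace ℂ (HB α) := NormedSpace.ofCore (normedSpaceCore α)

/-- The composition operator `f ↦ f ∘ φ`, on all functions on the disk. -/
def compOp (φ : ℂ → ℂ) (hφ : Set.MapsTo φ disk disk) : (disk → ℂ) →ₗ[ℂ] (disk → ℂ) :=
  LinearMap.funLeft ℂ ℂ (hφ.restrict φ disk disk)

/-- The composition operator as a linear map of `HB(α)` into itself, when it maps the space into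
itself. -/
def compOpHB (α : ℝ) (φ : ℂ → ℂ) (hφ : Set.MapsTo φ disk disk)
    (h : ∀ f ∈ submodule α, compOp φ hφ f ∈ submodule α) : HB α →ₗ[ℂ] HB α :=
  (compOp φ hφ).restrict h

/-- `C_φ : HB(α) → HB(α)` is compact: it maps `HB(α)` into itself, and is a compact operator for
the Bloch norm. -/
def CompositionCompact (α : ℝ) (φ : ℂ → ℂ) (hφ : Set.MapsTo φ disk disk) : Prop :=
  ∃ h : ∀ f ∈ submodule α, compOp φ hφ f ∈ submodule α,
    IsCompactOperator (compOpHB α φ hφ h)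

/-- The quantity `((1 - |z|²) / (1 - |φ(z)|²))^α |φ'(z)|`. -/
def tau (α : ℝ) (φ : ℂ → ℂ) (z : ℂ) : ℝ :=
  ((1 - ‖z‖ ^ 2) / (1 - ‖φ z‖ ^ 2)) ^ α * ‖deriv φ z‖

end HarmonicBloch

end

/-! Write a harmonic `f` as `h + conj g` with `h`, `g` holomorphic; then `|f_z| + |f_{z̄}| = |h'| +
|g'|`, and the chain rule shows that composition multiplies the weighted derivative by `tau`: its
value at `z` is `tau α φ z` times the old value at `φ z` (`weighted_compOp`).

If `tau` is bounded and vanishes as `|φ z| → 1`, the operator is compact. Every ultrafilter on the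
unit ball converges locally uniformly, with first derivatives, to a point of the ball
(`exists_limit_of_ultrafilter`). After composition the convergence is in norm: where `|φ z| ≤ r` it
is uniform and `tau` is bounded, and where `|φ z| > r` the small `tau` beats the bounded norm.

Conversely, `peak α a` has norm bounded in `a`, weighted derivative `|a|` at `a`, and tends to `0`
pointwise with its derivative as `|a| → 1`. Taking `a = φ z` bounds `tau α φ z * |φ z|` by the norm
of the image (`tau_mul_norm_le`); compactness turns pointwise decay into norm decay. -/

namespace HarmonicBloch

open scoped ComplexConjugate

/-! ### Splitting harmonic functions into holomorphic parts -/

/-- `f = h + conj g` on the disk, with `h` and `g` holomorphic there. -/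
structure Splitting (f : disk → ℂ) (h g : ℂ → ℂ) : Prop where
  left : DifferentiableOn ℂ h disk
  right : DifferentiableOn ℂ g disk
  eq : ∀ z : disk, f z = h z + conj (g z)

theorem hasDerivAt_of_differentiableOn_disk {h : ℂ → ℂ} (hh : DifferentiableOn ℂ h disk) (z : disk) :
    HasDerivAt h (deriv h z) z :=
  ((hh z z.2).differentiableAt (Metric.isOpen_ball.mem_nhds z.2)).hasDerivAt

namespace Splitting

variable {f f' : disk → ℂ} {h g h' g' : ℂ → ℂ}

theorem extend_eventuallyEq (H : Splitting f h g) (z : disk) :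
    extend f =ᶠ[𝓝 (z : ℂ)] h + Complex.conjCLE ∘ g := by
  filter_upwards [Metric.isOpen_ball.mem_nhds z.2] with w hw
  exact (extend_coe f ⟨w, hw⟩).trans (H.eq ⟨w, hw⟩)

theorem harmonicOnNhd (H : Splitting f h g) :
    InnerProductSpace.HarmonicOnNhd (extend f) disk := fun z hz => by
  have h1 := (H.left.analyticOnNhd Metric.isOpen_ball z hz).harmonicAt
  have h2 := (H.right.analyticOnNhd Metric.isOpen_ball z hz).harmonicAt
  exact (InnerProductSpace.harmonicAt_congr_nhds (H.extend_eventuallyEq ⟨z, hz⟩)).2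
    (h1.add (h2.comp_CLM (Complex.conjCLE : ℂ →L[ℝ] ℂ)))

theorem fderiv_apply (H : Splitting f h g) (z : disk) (w : ℂ) :
    fderiv ℝ (extend f) z w = deriv h z * w + conj (deriv g z * w) := by
  have h1 := (hasDerivAt_of_differentiableOn_disk H.left z).hasFDerivAt.restrictScalars ℝ
  have h2 := (hasDerivAt_of_differentiableOn_disk H.right z).hasFDerivAt.restrictScalars ℝ
  have h3 := (Complex.conjCLE : ℂ →L[ℝ] ℂ).hasFDerivAt (x := g z) |>.comp (z : ℂ) h2
  rw [(H.extend_eventuallyEq z).fderiv_eq]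
  have h4 := (h1.add h3).fderiv
  refine (congrArg (fun L : ℂ →L[ℝ] ℂ => L w) h4).trans ?_
  simp [mul_comm]

theorem dz_eq (H : Splitting f h g) (z : disk) : dz (extend f) z = deriv h z := by
  simp only [dz, H.fderiv_apply, map_mul, Complex.conj_I, map_one]
  linear_combination (-1 / 2 * deriv h z + 1 / 2 * conj (deriv g z)) * Complex.I_mul_I

theorem dzbar_eq (H : Splitting f h g) (z : disk) :
    dzbar (extend f) z = conj (deriv g z) := by
  simp only [dzbar, H.fderiv_apply, map_mul, Complex.conj_I, map_one]
  linear_combination (1 / 2 * deriv h z - 1 / 2 * conj (deriv g z)) * Complex.I_mul_I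

theorem weighted_eq (H : Splitting f h g) (α : ℝ) (z : disk) :
    weighted α f z = (1 - ‖(z : ℂ)‖ ^ 2) ^ α * (‖deriv h z‖ + ‖deriv g z‖) := by
  rw [weighted, H.dz_eq, H.dzbar_eq, Complex.norm_conj]

theorem sub (H : Splitting f h g) (H' : Splitting f' h' g') :
    Splitting (f - f') (h - h') (g - g') where
  left := H.left.sub H'.left
  right := H.right.sub H'.right
  eq z := by
    simp only [Pi.sub_apply, H.eq, H'.eq, map_sub]
    ring

theorem compOp {φ : ℂ → ℂ} (hφ : DifferentiableOn ℂ φ disk) (hm : Set.MapsTo φ disk disk)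
    (H : Splitting f h g) : Splitting (compOp φ hm f) (h ∘ φ) (g ∘ φ) where
  left := H.left.comp hφ hm
  right := H.right.comp hφ hm
  eq z := H.eq ⟨φ z, hm z.2⟩

end Splitting

/-- The real and imaginary parts of `f` are the real parts of holomorphic `F` and `G`, so `f = (F +
iG)/2 + conj ((F - iG)/2)`. Moving the constant `c` between the two terms gives `g 0 = 0`; hence `h
0 = f 0`, and a norm bound on `f` controls both parts at the centre. -/
theorem exists_splitting {f : disk → ℂ}
    (hf : InnerProductSpace.HarmonicOnNhd (extend f) disk) :
    ∃ h g : ℂ → ℂ, Splitting f h g ∧ g 0 = 0 := by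
  obtain ⟨F, hF, hFe⟩ := (hf.comp_CLM Complex.reCLM).exists_analyticOnNhd_ball_re_eq
  obtain ⟨G, hG, hGe⟩ := (hf.comp_CLM Complex.imCLM).exists_analyticOnNhd_ball_re_eq
  have hFd := hF.differentiableOn
  have hGd := hG.differentiableOn
  set c : ℂ := (F 0 - Complex.I * G 0) / 2
  refine ⟨fun z => (F z + Complex.I * G z) / 2 + conj c,
    fun z => (F z - Complex.I * G z) / 2 - c, ⟨?_, ?_, fun z => ?_⟩, by simp [c]⟩
  · exact ((hFd.add (hGd.const_mul _)).div_const _).add_const _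
  · exact ((hFd.sub (hGd.const_mul _)).div_const _).sub_const _
  · have h1 : (F z).re = (f z).re := by simpa [extend_coe] using hFe z.2
    have h2 : (G z).re = (f z).im := by simpa [extend_coe] using hGe z.2
    have h3 := Complex.add_conj (F z)
    have h4 := Complex.add_conj (G z)
    have h5 := Complex.re_add_im (f z)
    simp only [map_sub, map_div₀, map_mul, Complex.conj_I, map_ofNat]
    rw [h1] at h3
    rw [h2] at h4
    push_cast at h3 h4
    linear_combination -h5 - h3 / 2 - h4 / 2 * Complex.I

theorem isHarmonicBloch_of_le {α : ℝ} {f : disk → ℂ} {h g : ℂ → ℂ} (H : Splitting f h g) {C : ℝ}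
    (hC : ∀ z, weighted α f z ≤ C) : IsHarmonicBloch α f :=
  ⟨H.harmonicOnNhd, C, by rintro _ ⟨z, rfl⟩; exact hC z⟩

theorem weighted_le_norm {α : ℝ} (f : HB α) (z : disk) : weighted α f.1 z ≤ ‖f‖ :=
  (le_ciSup f.2.2 z).trans (le_add_of_nonneg_left (norm_nonneg _))

theorem norm_center_le {α : ℝ} (f : HB α) : ‖f.1 center‖ ≤ ‖f‖ :=
  le_add_of_nonneg_right (Real.iSup_nonneg (weighted_nonneg α f.1))

theorem norm_le_add {α : ℝ} {f : HB α} {a b : ℝ} (ha : ‖f.1 center‖ ≤ a)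
    (hb : ∀ z, weighted α f.1 z ≤ b) : ‖f‖ ≤ a + b :=
  haveI : Nonempty disk := ⟨center⟩
  add_le_add ha (ciSup_le hb)

/-! ### Normal families along ultrafilters -/

/-- A locally bounded family of holomorphic functions on the disk converges locally uniformly along
every ultrafilter. -/
theorem exists_tendstoLocallyUniformlyOn_ultrafilter {ι : Type*} (V : Ultrafilter ι)
    {H : ι → ℂ → ℂ} (hd : ∀ i, DifferentiableOn ℂ (H i) disk) {c : ℝ} (hc : ∀ i, ‖H i 0‖ ≤ c)
    (hC : ∀ r < 1, ∃ C, ∀ i, ∀ z ∈ Metric.ball (0 : ℂ) r, ‖deriv (H i) z‖ ≤ C) :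
    ∃ L, TendstoLocallyUniformlyOn H L V disk := by
  -- The derivative bounds give a Lipschitz constant common to all `i`. It keeps the values in a
  -- compact ball, giving pointwise limits, and then makes the convergence locally uniform.
  have lip : ∀ r < 1, ∃ C, 0 ≤ C ∧ ∀ i, ∀ z ∈ Metric.ball (0 : ℂ) r, ∀ w ∈ Metric.ball (0 : ℂ) r,
      ‖H i w - H i z‖ ≤ C * ‖w - z‖ := fun r hr => by
    obtain ⟨C, hC⟩ := hC r hr
    refine ⟨max C 0, le_max_right _ _, fun i z hz w hw => ?_⟩
    exact (convex_ball (0 : ℂ) r).norm_image_sub_le_of_norm_deriv_le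
      (fun x hx => (hasDerivAt_of_differentiableOn_disk (hd i)
        ⟨x, Metric.ball_subset_ball hr.le hx⟩).differentiableAt)
      (fun x hx => (hC i x hx).trans (le_max_left _ _)) hz hw
  have hr : ∀ z ∈ disk, ∃ r < 1, z ∈ Metric.ball (0 : ℂ) r ∧ 0 < r := fun z hz => by
    obtain ⟨r, h1, h2⟩ := exists_between (mem_ball_zero_iff.1 hz)
    exact ⟨r, h2, mem_ball_zero_iff.2 h1, (norm_nonneg z).trans_lt h1⟩
  have hlim : ∀ z ∈ disk, ∃ l, Tendsto (fun i => H i z) V (𝓝 l) := fun z hz => by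
    obtain ⟨r, hr1, hzr, hr0⟩ := hr z hz
    obtain ⟨C, hC0, hC⟩ := lip r hr1
    obtain ⟨l, -, hl⟩ := (isCompact_closedBall (0 : ℂ) (c + C * ‖z‖)).ultrafilter_le_nhds
      (V.map fun i => H i z) (by
        rw [le_principal_iff, Ultrafilter.mem_coe, Ultrafilter.mem_map]
        refine Filter.univ_mem' fun i => ?_
        have := hC i 0 (Metric.mem_ball_self hr0) z hzr
        rw [sub_zero] at this
        rw [Set.mem_preimage, mem_closedBall_zero_iff]
        linarith [norm_sub_norm_le (H i z) (H i 0), hc i])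
    exact ⟨l, hl⟩
  choose! L hL using hlim
  refine ⟨L, Metric.tendstoLocallyUniformlyOn_iff.2 fun ε hε x hx => ?_⟩
  obtain ⟨r, hr1, hxr, hr0⟩ := hr x hx
  obtain ⟨C, hC0, hC⟩ := lip r hr1
  have hLlip : ∀ w ∈ Metric.ball (0 : ℂ) r, ‖L w - L x‖ ≤ C * ‖w - x‖ := fun w hw =>
    le_of_tendsto ((hL w (Metric.ball_subset_ball hr1.le hw)).sub (hL x hx)).norm
      (Eventually.of_forall fun i => hC i x hxr w hw)
  -- The radius makes each Lipschitz error at most `ε / 3`; `C + 1` guards against `C = 0`.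
  refine ⟨Metric.ball 0 r ∩ Metric.ball x (ε / (3 * (C + 1))), mem_nhdsWithin_of_mem_nhds
    (inter_mem (Metric.isOpen_ball.mem_nhds hxr) (Metric.ball_mem_nhds _ (by positivity))), ?_⟩
  filter_upwards [Metric.tendsto_nhds.1 (hL x hx) (ε / 3) (by positivity)] with i hi y hy
  have h1 : C * ‖y - x‖ ≤ ε / 3 := by
    have h2 := mem_ball_iff_norm.1 hy.2
    rw [lt_div_iff₀ (by positivity)] at h2
    nlinarith [norm_nonneg (y - x)]
  have h2 := hLlip y hy.1
  have h3 := hC i x hxr y hy.1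
  rw [dist_eq_norm] at hi
  rw [norm_sub_rev] at h3 hi
  rw [dist_eq_norm]
  calc ‖L y - H i y‖ = ‖(L y - L x) + (L x - H i x) + (H i x - H i y)‖ := by congr 1; ring
    _ ≤ _ := norm_add₃_le
    _ < ε := by linarith

/-! ### Composition and the weight -/

theorem one_sub_sq_pos (z : disk) : 0 < 1 - ‖(z : ℂ)‖ ^ 2 := by
  have hz : ‖(z : ℂ)‖ < 1 := mem_ball_zero_iff.1 z.2
  nlinarith [norm_nonneg (z : ℂ)]

theorem weight_le_one {α : ℝ} (hα : 0 < α) (z : disk) : (1 - ‖(z : ℂ)‖ ^ 2) ^ α ≤ 1 :=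
  Real.rpow_le_one (one_sub_sq_pos z).le (by nlinarith [norm_nonneg (z : ℂ)]) hα.le

theorem tau_nonneg {α : ℝ} {φ : ℂ → ℂ} (hm : Set.MapsTo φ disk disk) (z : disk) :
    0 ≤ tau α φ z :=
  mul_nonneg (Real.rpow_nonneg (div_nonneg (one_sub_sq_pos z).le
    (one_sub_sq_pos ⟨φ z, hm z.2⟩).le) _) (norm_nonneg _)

theorem Splitting.weighted_compOp {α : ℝ} {φ : ℂ → ℂ} (hφ : DifferentiableOn ℂ φ disk)
    (hm : Set.MapsTo φ disk disk) {f : disk → ℂ} {h g : ℂ → ℂ} (H : Splitting f h g) (z : disk) :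
    weighted α (HarmonicBloch.compOp φ hm f) z = tau α φ z * weighted α f ⟨φ z, hm z.2⟩ := by
  have h0 := hasDerivAt_of_differentiableOn_disk hφ z
  have h1 := (hasDerivAt_of_differentiableOn_disk H.left ⟨φ z, hm z.2⟩).comp (z : ℂ) h0
  have h2 := (hasDerivAt_of_differentiableOn_disk H.right ⟨φ z, hm z.2⟩).comp (z : ℂ) h0
  have hw := (weight_pos α ⟨φ z, hm z.2⟩).ne'
  rw [(H.compOp hφ hm).weighted_eq, H.weighted_eq, h1.deriv, h2.deriv, tau,
    Real.div_rpow (one_sub_sq_pos z).le (one_sub_sq_pos ⟨φ z, hm z.2⟩).le]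
  simp only [norm_mul] at hw ⊢
  field_simp

theorem weighted_compOp {α : ℝ} {φ : ℂ → ℂ} (hφ : DifferentiableOn ℂ φ disk)
    (hm : Set.MapsTo φ disk disk) (f : HB α) (z : disk) :
    weighted α (compOp φ hm f.1) z = tau α φ z * weighted α f.1 ⟨φ z, hm z.2⟩ := by
  obtain ⟨h, g, H, -⟩ := exists_splitting f.2.1
  exact H.weighted_compOp hφ hm z

theorem compOp_mem {α : ℝ} {φ : ℂ → ℂ} (hφ : DifferentiableOn ℂ φ disk)
    (hm : Set.MapsTo φ disk disk) {M : ℝ} (hM : ∀ z : disk, tau α φ z ≤ M) (f : disk → ℂ)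
    (hf : f ∈ submodule α) : compOp φ hm f ∈ submodule α := by
  obtain ⟨h, g, H, -⟩ := exists_splitting hf.1
  obtain ⟨C, hC⟩ := hf.2
  refine isHarmonicBloch_of_le (C := M * C) (H.compOp hφ hm) fun z => ?_
  rw [H.weighted_compOp hφ hm]
  exact mul_le_mul (hM z) (hC ⟨_, rfl⟩) (weighted_nonneg _ _ _)
    ((tau_nonneg hm z).trans (hM z))

/-! ### Sufficiency: decay of `tau` gives compactness -/

/-- On the closed unit ball of `HB(α)`, every ultrafilter converges, locally uniformly on the disk
together with first derivatives, to a point of the ball. -/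
theorem exists_limit_of_ultrafilter {α : ℝ} (hα : 0 < α)
    (V : Ultrafilter (Metric.closedBall (0 : HB α) 1)) :
    ∃ f ∈ Metric.closedBall (0 : HB α) 1,
      (∀ z : disk, Tendsto (fun i : Metric.closedBall (0 : HB α) 1 => i.1.1 z) V (𝓝 (f.1 z))) ∧
      ∀ r < 1, ∀ ε > 0, ∀ᶠ i : Metric.closedBall (0 : HB α) 1 in V, ∀ w : disk, ‖(w : ℂ)‖ ≤ r →
        weighted α (i.1.1 - f.1) w ≤ ε := by
  have hsp : ∀ i : Metric.closedBall (0 : HB α) 1,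
      ∃ h g : ℂ → ℂ, Splitting i.1.1 h g ∧ g 0 = 0 := fun i => exists_splitting i.1.2.1
  choose h g H hg0 using hsp
  have hn : ∀ i : Metric.closedBall (0 : HB α) 1, ‖i.1‖ ≤ 1 := fun i =>
    mem_closedBall_zero_iff.1 i.2
  have hbd : ∀ r < 1, ∃ C, ∀ i, ∀ z ∈ Metric.ball (0 : ℂ) r,
      ‖deriv (h i) z‖ ≤ C ∧ ‖deriv (g i) z‖ ≤ C := fun r hr => by
    -- On the ball of radius `r` the weight is at least `(1 - r ^ 2) ^ α`, and the norm is at most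
    -- `1`.
    refine ⟨((1 - r ^ 2) ^ α)⁻¹, fun i z hz => ?_⟩
    have hzr := mem_ball_zero_iff.1 hz
    have hr0 : 0 ≤ r := (norm_nonneg z).trans hzr.le
    have hz1 : z ∈ disk := Metric.ball_subset_ball hr.le hz
    have hpos : 0 < (1 - r ^ 2) ^ α := Real.rpow_pos_of_pos (by nlinarith) α
    have h1 := (weighted_le_norm i.1 ⟨z, hz1⟩).trans (hn i)
    rw [(H i).weighted_eq] at h1
    have h2 : (1 - r ^ 2) ^ α ≤ (1 - ‖z‖ ^ 2) ^ α :=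
      Real.rpow_le_rpow (by nlinarith) (by nlinarith [norm_nonneg z]) hα.le
    have h3 : ‖deriv (h i) z‖ + ‖deriv (g i) z‖ ≤ ((1 - r ^ 2) ^ α)⁻¹ := by
      rw [← one_div, le_div_iff₀ hpos, mul_comm]
      exact (mul_le_mul_of_nonneg_right h2 (by positivity)).trans h1
    constructor <;> linarith [norm_nonneg (deriv (h i) z), norm_nonneg (deriv (g i) z)]
  obtain ⟨hL, hhL⟩ := exists_tendstoLocallyUniformlyOn_ultrafilter V (fun i => (H i).left) (c := 1)
    (fun i => by
      have h1 := (norm_center_le i.1).trans (hn i)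
      rw [(H i).eq] at h1
      simpa [center, hg0] using h1)
    (fun r hr => (hbd r hr).imp fun C hC i z hz => (hC i z hz).1)
  obtain ⟨gL, hgL⟩ := exists_tendstoLocallyUniformlyOn_ultrafilter V (fun i => (H i).right) (c := 0)
    (fun i => by rw [hg0, norm_zero])
    (fun r hr => (hbd r hr).imp fun C hC i z hz => (hC i z hz).2)
  have HL : Splitting (fun z : disk => hL z + conj (gL z)) hL gL :=
    ⟨hhL.differentiableOn (Eventually.of_forall fun i => (H i).left) Metric.isOpen_ball,
      hgL.differentiableOn (Eventually.of_forall fun i => (H i).right) Metric.isOpen_ball,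
      fun _ => rfl⟩
  have hdh := hhL.deriv (Eventually.of_forall fun i => (H i).left) Metric.isOpen_ball
  have hdg := hgL.deriv (Eventually.of_forall fun i => (H i).right) Metric.isOpen_ball
  set f : disk → ℂ := fun z => hL z + conj (gL z)
  have hpt : ∀ z : disk, Tendsto (fun i : Metric.closedBall (0 : HB α) 1 => i.1.1 z) V
      (𝓝 (f z)) := fun z => by
    simp only [fun i => (H i).eq z]
    exact (hhL.tendsto_at z.2).add
      ((Complex.continuous_conj.tendsto _).comp (hgL.tendsto_at z.2))
  have hwt : ∀ z : disk, Tendsto (fun i : Metric.closedBall (0 : HB α) 1 => weighted α i.1.1 z) V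
      (𝓝 (weighted α f z)) := fun z => by
    simp only [fun i => (H i).weighted_eq α z, HL.weighted_eq]
    exact ((hdh.tendsto_at z.2).norm.add (hdg.tendsto_at z.2).norm).const_mul _
  -- Passing to the limit in the sum, not in each term separately, keeps `f` in the unit ball
  -- itself.
  have hsum : ∀ z, ‖f center‖ + weighted α f z ≤ 1 := fun z =>
    le_of_tendsto ((hpt center).norm.add (hwt z)) (Eventually.of_forall fun i =>
      (add_le_add_right (le_ciSup i.1.2.2 z) _).trans (hn i))
  have hfB : IsHarmonicBloch α f := isHarmonicBloch_of_le HL (C := 1) fun z => by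
    linarith [hsum z, norm_nonneg (f center)]
  refine ⟨⟨f, hfB⟩, ?_, hpt, fun r hr ε hε => ?_⟩
  · refine mem_closedBall_zero_iff.2 ((norm_le_add (a := ‖f center‖) (b := 1 - ‖f center‖)
      le_rfl fun z => ?_).trans (by linarith))
    exact le_sub_iff_add_le'.2 (hsum z)
  · have hK : Metric.closedBall (0 : ℂ) r ⊆ disk := Metric.closedBall_subset_ball hr
    have u1 := Metric.tendstoUniformlyOn_iff.1 ((tendstoLocallyUniformlyOn_iff_forall_isCompact
      Metric.isOpen_ball).1 hdh _ hK (isCompact_closedBall _ _)) (ε / 2) (by positivity)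
    have u2 := Metric.tendstoUniformlyOn_iff.1 ((tendstoLocallyUniformlyOn_iff_forall_isCompact
      Metric.isOpen_ball).1 hdg _ hK (isCompact_closedBall _ _)) (ε / 2) (by positivity)
    filter_upwards [u1, u2] with i h1 h2 w hw
    have hd1 := (hasDerivAt_of_differentiableOn_disk (H i).left w).sub
      (hasDerivAt_of_differentiableOn_disk HL.left w)
    have hd2 := (hasDerivAt_of_differentiableOn_disk (H i).right w).sub
      (hasDerivAt_of_differentiableOn_disk HL.right w)
    have h1 := h1 w (mem_closedBall_zero_iff.2 hw)
    have h2 := h2 w (mem_closedBall_zero_iff.2 hw)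
    rw [dist_comm, dist_eq_norm] at h1 h2
    refine ((((H i).sub HL).weighted_eq α w).trans_le (mul_le_of_le_one_left (by positivity)
      (weight_le_one hα w))).trans ?_
    rw [hd1.deriv, hd2.deriv]
    simp only [Function.comp_apply] at h1 h2
    linarith

theorem compositionCompact_of_tau {α : ℝ} (hα : 0 < α) {φ : ℂ → ℂ}
    (hφ : DifferentiableOn ℂ φ disk) (hm : Set.MapsTo φ disk disk)
    (hb : BddAbove (Set.range fun z : disk => tau α φ z))
    (ht : Tendsto (fun z : disk => tau α φ z)
      (comap (fun z : disk => ‖φ z‖) (𝓝[<] 1)) (𝓝 0)) :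
    CompositionCompact α φ hm := by
  obtain ⟨M, hM⟩ := hb
  replace hM : ∀ z : disk, tau α φ z ≤ M := fun z => hM ⟨z, rfl⟩
  have hM0 : 0 ≤ M := (tau_nonneg hm center).trans (hM center)
  have hmem := compOp_mem hφ hm hM
  refine ⟨hmem, (isCompactOperator_iff_image_closedBall_subset_compact (compOpHB α φ hm hmem)
    one_pos).2 ⟨_, ?_, subset_rfl⟩⟩
  set T := compOpHB α φ hm hmem
  refine isCompact_iff_ultrafilter_le_nhds'.2 fun U hU => ?_
  -- Lift the ultrafilter `U` on the image to one on the ball, where limits exist. As the limit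
  -- stays in the ball, the image is itself compact.
  have hU' : (fun i : Metric.closedBall (0 : HB α) 1 => T i) '' Set.univ ∈ U := by
    rwa [Set.image_univ, ← Set.image_eq_range]
  set V := Ultrafilter.ofComapInfPrincipal hU'
  have hVU : V.map (fun i : Metric.closedBall (0 : HB α) 1 => T i) = U :=
    Ultrafilter.ofComapInfPrincipal_eq_of_map hU'
  obtain ⟨f, hfB, hpt, huc⟩ := exists_limit_of_ultrafilter hα V
  refine ⟨T f, ⟨f, hfB, rfl⟩, ?_⟩
  rw [← hVU]
  change Tendsto (fun i : Metric.closedBall (0 : HB α) 1 => T i) V (𝓝 (T f))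
  rw [Metric.tendsto_nhds]
  intro ε hε
  -- `ε / 6` because two points of the unit ball differ by at most `2` in norm.
  obtain ⟨r, hr1, hr⟩ : ∃ r < 1, ∀ z : disk, r < ‖φ z‖ → tau α φ z < ε / 6 := by
    have h1 := ht.eventually (gt_mem_nhds (show (0 : ℝ) < ε / 6 by positivity))
    rw [eventually_comap] at h1
    obtain ⟨r, hr1, hr⟩ := (mem_nhdsLT_iff_exists_Ioo_subset.1 h1)
    exact ⟨r, hr1, fun z hz => hr ⟨hz, mem_ball_zero_iff.1 (hm z.2)⟩ z rfl⟩
  filter_upwards [huc r hr1 (ε / (3 * (M + 1))) (by positivity),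
    Metric.tendsto_nhds.1 (hpt ⟨φ 0, hm center.2⟩) (ε / 3) (by positivity)] with i hi hi0
  rw [dist_eq_norm, ← map_sub]
  refine (norm_le_add (a := ε / 3) (b := ε / 3) ?_ fun z => ?_).trans_lt (by linarith)
  · rw [dist_eq_norm] at hi0
    exact hi0.le
  · refine (weighted_compOp hφ hm (i.1 - f) z).trans_le ?_
    rcases le_or_gt ‖φ z‖ r with hz | hz
    · have h1 := mul_le_mul (hM z) (hi ⟨φ z, hm z.2⟩ hz) (weighted_nonneg _ _ _) hM0
      refine h1.trans ?_
      rw [mul_div_assoc', div_le_iff₀ (by positivity)]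
      nlinarith
    · have h1 : ‖i.1 - f‖ ≤ 2 := (norm_sub_le _ _).trans (by
        linarith [mem_closedBall_zero_iff.1 i.2, mem_closedBall_zero_iff.1 hfB])
      have h2 := mul_le_mul (hr z hz).le ((weighted_le_norm (i.1 - f) ⟨φ z, hm z.2⟩).trans h1)
        (weighted_nonneg _ _ _) (by positivity)
      linarith

/-! ### Test functions -/

/-- A holomorphic function peaking at `a` in the `α`-Bloch seminorm, vanishing at the centre. -/
noncomputable def peak (α : ℝ) (a z : ℂ) : ℂ :=
  ((1 - ‖a‖ ^ 2) / α : ℝ) * ((1 - conj a * z) ^ ((-α : ℝ) : ℂ) - 1)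

/-- The free `w` allows both `w = a` and `w = z`. -/
theorem one_sub_norm_le_norm_one_sub {a w z : ℂ} (hw : ‖a‖ * ‖z‖ ≤ ‖w‖) :
    1 - ‖w‖ ≤ ‖1 - conj a * z‖ := by
  have h1 := norm_sub_norm_le (1 : ℂ) (conj a * z)
  rw [norm_one, norm_mul, Complex.norm_conj] at h1
  linarith

theorem one_sub_conj_mul_mem_slitPlane (a z : disk) :
    1 - conj (a : ℂ) * z ∈ Complex.slitPlane := by
  have h1 : ‖(a : ℂ)‖ < 1 := mem_ball_zero_iff.1 a.2
  have h2 : ‖(z : ℂ)‖ < 1 := mem_ball_zero_iff.1 z.2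
  have h3 := Complex.re_le_norm (conj (a : ℂ) * z)
  rw [norm_mul, Complex.norm_conj] at h3
  left
  rw [Complex.sub_re, Complex.one_re]
  nlinarith [norm_nonneg (a : ℂ), norm_nonneg (z : ℂ)]

theorem hasDerivAt_peak {α : ℝ} (hα : 0 < α) (a z : disk) :
    HasDerivAt (peak α a)
      ((1 - ‖(a : ℂ)‖ ^ 2 : ℝ) * (conj (a : ℂ) * (1 - conj (a : ℂ) * z) ^ ((-(α + 1) : ℝ) : ℂ)))
      z := by
  have h1 : HasDerivAt (fun z : ℂ => 1 - conj (a : ℂ) * z) (-conj (a : ℂ)) (z : ℂ) := by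
    simpa using ((hasDerivAt_id (z : ℂ)).const_mul (conj (a : ℂ))).const_sub 1
  have h2 := (((h1.cpow_const (c := ((-α : ℝ) : ℂ)) (one_sub_conj_mul_mem_slitPlane a z)).sub_const
    1).const_mul (((1 - ‖(a : ℂ)‖ ^ 2) / α : ℝ) : ℂ))
  refine h2.congr_deriv ?_
  have h3 : (((-α : ℝ) : ℂ) - 1) = ((-(α + 1) : ℝ) : ℂ) := by push_cast; ring
  have h4 : (α : ℂ) ≠ 0 := by exact_mod_cast hα.ne'
  rw [h3]
  push_cast
  field_simp

theorem splitting_of_differentiableOn {h : ℂ → ℂ} (hh : DifferentiableOn ℂ h disk) :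
    Splitting (fun z => h z) h 0 :=
  ⟨hh, differentiableOn_const 0, fun z => by simp⟩

theorem splitting_peak {α : ℝ} (hα : 0 < α) (a : disk) :
    Splitting (fun z => peak α a z) (peak α a) 0 :=
  splitting_of_differentiableOn fun z hz =>
    (hasDerivAt_peak hα a ⟨z, hz⟩).differentiableAt.differentiableWithinAt

theorem weighted_peak {α : ℝ} (hα : 0 < α) (a z : disk) :
    weighted α (fun z => peak α a z) z = (1 - ‖(z : ℂ)‖ ^ 2) ^ α *
      ((1 - ‖(a : ℂ)‖ ^ 2) * (‖(a : ℂ)‖ * ‖1 - conj (a : ℂ) * z‖ ^ (-(α + 1)))) := by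
  rw [(splitting_peak hα a).weighted_eq, (hasDerivAt_peak hα a z).deriv, norm_mul, norm_mul,
    Complex.norm_cpow_real, Complex.norm_conj, Complex.norm_real,
    Real.norm_of_nonneg (one_sub_sq_pos a).le]
  simp

/-- At `z = a` the factor `|1 - conj a * z|` equals `1 - |a|²`, and the powers `α`, `1` and `-(α +
1)` cancel. -/
theorem weighted_peak_self {α : ℝ} (hα : 0 < α) (a : disk) :
    weighted α (fun z => peak α a z) a = ‖(a : ℂ)‖ := by
  have hs := one_sub_sq_pos a
  have h1 : ‖1 - conj (a : ℂ) * a‖ = 1 - ‖(a : ℂ)‖ ^ 2 := by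
    rw [Complex.conj_mul', ← Complex.ofReal_pow, ← Complex.ofReal_one, ← Complex.ofReal_sub,
      Complex.norm_real, Real.norm_of_nonneg hs.le]
  rw [weighted_peak hα, h1, Real.rpow_neg hs.le, Real.rpow_add_one hs.ne']
  have := Real.rpow_pos_of_pos hs α
  field_simp

/-- With `t = |1 - conj a * z|`, both `1 - |z|²` and `1 - |a|²` are at most `2t`, which absorbs `t ^
(-(α + 1))` uniformly in `a` and `z`. -/
theorem weighted_peak_le {α : ℝ} (hα : 0 < α) (a z : disk) :
    weighted α (fun z => peak α a z) z ≤ 2 ^ α * 2 := by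
  have ha : ‖(a : ℂ)‖ < 1 := mem_ball_zero_iff.1 a.2
  have hz : ‖(z : ℂ)‖ < 1 := mem_ball_zero_iff.1 z.2
  have ha0 := norm_nonneg (a : ℂ)
  have hz0 := norm_nonneg (z : ℂ)
  have h1 : 1 - ‖(a : ℂ)‖ ≤ ‖1 - conj (a : ℂ) * z‖ :=
    one_sub_norm_le_norm_one_sub (by nlinarith)
  have h2 : 1 - ‖(z : ℂ)‖ ≤ ‖1 - conj (a : ℂ) * z‖ :=
    one_sub_norm_le_norm_one_sub (by nlinarith)
  rw [weighted_peak hα]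
  set t := ‖1 - conj (a : ℂ) * z‖
  have ht : 0 < t := by linarith
  have htα := Real.rpow_pos_of_pos ht α
  have h3 : (1 - ‖(z : ℂ)‖ ^ 2) ^ α ≤ 2 ^ α * t ^ α := by
    rw [← Real.mul_rpow (by norm_num) ht.le]
    exact Real.rpow_le_rpow (one_sub_sq_pos z).le (by nlinarith) hα.le
  have h4 : (1 - ‖(a : ℂ)‖ ^ 2) * ‖(a : ℂ)‖ ≤ 2 * t := by
    nlinarith [one_sub_sq_pos a]
  calc _ = (1 - ‖(z : ℂ)‖ ^ 2) ^ α * ((1 - ‖(a : ℂ)‖ ^ 2) * ‖(a : ℂ)‖) * t ^ (-(α + 1)) := by ring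
    _ ≤ (2 ^ α * t ^ α) * (2 * t) * t ^ (-(α + 1)) := by
      gcongr
      exact mul_nonneg (one_sub_sq_pos a).le ha0
    _ = 2 ^ α * 2 := by
      rw [Real.rpow_neg ht.le, Real.rpow_add_one ht.ne']
      field_simp

/-- `peak α a` as an element of `HB(α)`. -/
noncomputable def peakHB {α : ℝ} (hα : 0 < α) (a : disk) : HB α :=
  ⟨fun z => peak α a z, isHarmonicBloch_of_le (splitting_peak hα a) (weighted_peak_le hα a)⟩

theorem norm_peakHB_le {α : ℝ} (hα : 0 < α) (a : disk) : ‖peakHB hα a‖ ≤ 2 ^ α * 2 := by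
  have h0 : ‖(peakHB hα a).1 center‖ ≤ 0 := by
    simp [peakHB, center, peak]
  have h1 := norm_le_add h0 (weighted_peak_le hα a)
  rwa [zero_add] at h1

theorem norm_one_sub_conj_mul_rpow_le {s : ℝ} (hs : s ≤ 0) (a z : disk) :
    ‖1 - conj (a : ℂ) * z‖ ^ s ≤ (1 - ‖(z : ℂ)‖) ^ s := by
  have ha : ‖(a : ℂ)‖ < 1 := mem_ball_zero_iff.1 a.2
  refine Real.rpow_le_rpow_of_nonpos (sub_pos.2 (mem_ball_zero_iff.1 z.2)) ?_ hs
  exact one_sub_norm_le_norm_one_sub (mul_le_of_le_one_left (norm_nonneg _) ha.le)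

theorem tendsto_one_sub_sq {ι : Type*} {l : Filter ι} {a : ι → disk}
    (ha : Tendsto (fun i => ‖(a i : ℂ)‖) l (𝓝 1)) :
    Tendsto (fun i => 1 - ‖(a i : ℂ)‖ ^ 2) l (𝓝 0) := by
  simpa using (ha.pow 2).const_sub 1

theorem tendsto_peak {α : ℝ} (hα : 0 < α) {ι : Type*} {l : Filter ι} {a : ι → disk}
    (ha : Tendsto (fun i => ‖(a i : ℂ)‖) l (𝓝 1)) (z : disk) :
    Tendsto (fun i => peak α (a i) z) l (𝓝 0) := by
  have h1 := ((tendsto_one_sub_sq ha).div_const α).mul_const ((1 - ‖(z : ℂ)‖) ^ (-α) + 1)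
  rw [zero_div, zero_mul] at h1
  refine squeeze_zero_norm (fun i => ?_) h1
  have h2 : 0 ≤ (1 - ‖(a i : ℂ)‖ ^ 2) / α := div_nonneg (one_sub_sq_pos _).le hα.le
  rw [peak, norm_mul, Complex.norm_real, Real.norm_of_nonneg h2]
  refine mul_le_mul_of_nonneg_left ((norm_sub_le _ _).trans ?_) h2
  rw [Complex.norm_cpow_real, norm_one]
  linarith [norm_one_sub_conj_mul_rpow_le (neg_nonpos.2 hα.le) (a i) z]

theorem tendsto_weighted_peak {α : ℝ} (hα : 0 < α) {ι : Type*} {l : Filter ι} {a : ι → disk}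
    (ha : Tendsto (fun i => ‖(a i : ℂ)‖) l (𝓝 1)) (z : disk) :
    Tendsto (fun i => weighted α (fun w => peak α (a i) w) z) l (𝓝 0) := by
  have h1 := (((tendsto_one_sub_sq ha).mul (ha.mul_const ((1 - ‖(z : ℂ)‖) ^ (-(α + 1))))).const_mul
    ((1 - ‖(z : ℂ)‖ ^ 2) ^ α))
  rw [zero_mul, mul_zero] at h1
  refine squeeze_zero (fun i => weighted_nonneg _ _ _) (fun i => ?_) h1
  rw [weighted_peak hα]
  have h2 := norm_one_sub_conj_mul_rpow_le (s := -(α + 1)) (by linarith) (a i) z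
  exact mul_le_mul_of_nonneg_left (mul_le_mul_of_nonneg_left (mul_le_mul_of_nonneg_left h2
    (norm_nonneg _)) (one_sub_sq_pos _).le) (weight_nonneg _ _)

theorem splitting_id : Splitting (fun z : disk => (z : ℂ)) id 0 :=
  splitting_of_differentiableOn differentiableOn_id

/-- The identity function as an element of `HB(α)`. -/
noncomputable def idHB {α : ℝ} (hα : 0 < α) : HB α :=
  ⟨fun z => (z : ℂ), isHarmonicBloch_of_le (C := 1)
    splitting_id fun z => by
      rw [splitting_id.weighted_eq]
      simpa using weight_le_one hα z⟩

theorem weighted_idHB {α : ℝ} (hα : 0 < α) (z : disk) :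
    weighted α (idHB hα).1 z = (1 - ‖(z : ℂ)‖ ^ 2) ^ α := by
  refine (splitting_id.weighted_eq α z).trans ?_
  simp

/-! ### Necessity: compactness controls `tau` -/

theorem tau_mul_norm_le {α : ℝ} (hα : 0 < α) {φ : ℂ → ℂ} (hφ : DifferentiableOn ℂ φ disk)
    (hm : Set.MapsTo φ disk disk) (h : ∀ f ∈ submodule α, compOp φ hm f ∈ submodule α) (z : disk) :
    tau α φ z * ‖φ z‖ ≤ ‖compOpHB α φ hm h (peakHB hα ⟨φ z, hm z.2⟩)‖ := by
  refine le_trans (le_of_eq ?_) (weighted_le_norm _ z)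
  exact (congrArg _ (weighted_peak_self hα ⟨φ z, hm z.2⟩).symm).trans
    (weighted_compOp hφ hm (peakHB hα ⟨φ z, hm z.2⟩) z).symm

theorem bddAbove_tau_of_compositionCompact {α : ℝ} (hα : 0 < α) {φ : ℂ → ℂ}
    (hφ : DifferentiableOn ℂ φ disk) (hm : Set.MapsTo φ disk disk)
    (hc : CompositionCompact α φ hm) : BddAbove (Set.range fun z : disk => tau α φ z) := by
  obtain ⟨h, hT⟩ := hc
  obtain ⟨K, hK, hTK⟩ := hT.image_closedBall_subset_compact (2 ^ α * 2)
  obtain ⟨M, hM⟩ := hK.isBounded.exists_norm_le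
  set N := ‖compOpHB α φ hm h (idHB hα)‖
  have hq : (0 : ℝ) < (3 / 4) ^ α := by positivity
  -- Peaks lose the factor `|φ z|`, so they serve for `|φ z| ≥ 1/2`, at the cost of a `2`. For `|φ
  -- z| ≤ 1/2` the identity function serves, its weight at `φ z` being at least `(1 - 1/4) ^ α`.
  refine ⟨max (2 * M) (N / (3 / 4) ^ α), ?_⟩
  rintro _ ⟨z, rfl⟩
  have ht := tau_nonneg (α := α) hm z
  rcases le_total ‖φ z‖ (1 / 2) with hz | hz
  · refine le_max_of_le_right ((le_div_iff₀ hq).2 ?_)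
    have h1 : tau α φ z * (1 - ‖φ z‖ ^ 2) ^ α ≤ N := by
      refine le_trans (le_of_eq ?_) (weighted_le_norm _ z)
      exact (congrArg _ (weighted_idHB hα ⟨φ z, hm z.2⟩).symm).trans
        (weighted_compOp hφ hm (idHB hα) z).symm
    refine (mul_le_mul_of_nonneg_left (Real.rpow_le_rpow (by norm_num) ?_ hα.le) ht).trans h1
    nlinarith [norm_nonneg (φ z)]
  · refine le_max_of_le_left ?_
    have h1 := (tau_mul_norm_le hα hφ hm h z).trans (hM _ (hTK ⟨_, mem_closedBall_zero_iff.2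
      (norm_peakHB_le hα _), rfl⟩))
    nlinarith

theorem tendsto_tau_of_compositionCompact {α : ℝ} (hα : 0 < α) {φ : ℂ → ℂ}
    (hφ : DifferentiableOn ℂ φ disk) (hm : Set.MapsTo φ disk disk)
    (hc : CompositionCompact α φ hm) :
    Tendsto (fun z : disk => tau α φ z)
      (comap (fun z : disk => ‖φ z‖) (𝓝[<] 1)) (𝓝 0) := by
  obtain ⟨h, hT⟩ := hc
  obtain ⟨K, hK, hTK⟩ := hT.image_closedBall_subset_compact (2 ^ α * 2)
  -- Along an ultrafilter the images of the peaks converge in norm within `K`, with no passage to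
  -- subsequences. If `|φ|` stays away from `1`, no such `U` exists.
  refine (tendsto_iff_ultrafilter _ _ _).2 fun U hU => ?_
  set T := compOpHB α φ hm h
  set p : disk → HB α := fun z => T (peakHB hα ⟨φ z, hm z.2⟩)
  have hφ1 : Tendsto (fun z : disk => ‖φ z‖) U (𝓝 1) :=
    (tendsto_comap.mono_left hU).mono_right nhdsWithin_le_nhds
  obtain ⟨g, -, hg⟩ := hK.ultrafilter_le_nhds (U.map p) (by
    rw [le_principal_iff, Ultrafilter.mem_coe, Ultrafilter.mem_map]
    exact Filter.univ_mem' fun z => hTK ⟨_, mem_closedBall_zero_iff.2 (norm_peakHB_le hα _), rfl⟩)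
  replace hg : Tendsto p U (𝓝 g) := hg
  have hsub : Tendsto (fun z => ‖g - p z‖) U (𝓝 0) := by
    simpa using (hg.const_sub g).norm
  have hpc : Tendsto (fun z => (p z).1 center) U (𝓝 0) :=
    tendsto_peak hα (a := fun z : disk => ⟨φ z, hm z.2⟩) hφ1 ⟨φ 0, hm center.2⟩
  have hpw : ∀ w : disk, Tendsto (fun z => weighted α (p z).1 w) U (𝓝 0) := fun w => by
    have h1 := (tendsto_weighted_peak hα (a := fun z : disk => ⟨φ z, hm z.2⟩) hφ1
      ⟨φ w, hm w.2⟩).const_mul (tau α φ w)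
    rw [mul_zero] at h1
    exact h1.congr fun z => (weighted_compOp hφ hm (peakHB hα ⟨φ z, hm z.2⟩) w).symm
  have hgc : ‖g.1 center‖ ≤ 0 := by
    refine ge_of_tendsto (by simpa using hsub.add hpc.norm) (Eventually.of_forall fun z => ?_)
    have h1 := norm_center_le (g - p z)
    have h2 : (g - p z).1 center = g.1 center - (p z).1 center := rfl
    rw [h2] at h1
    linarith [norm_sub_norm_le (g.1 center) ((p z).1 center)]
  have hgw : ∀ w, weighted α g.1 w ≤ 0 := fun w => by
    refine ge_of_tendsto (by simpa using hsub.add (hpw w)) (Eventually.of_forall fun z => ?_)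
    have h1 := weighted_add_le (g - p z).2 (p z).2 w
    have h2 : (g - p z).1 + (p z).1 = g.1 := sub_add_cancel g.1 (p z).1
    rw [h2] at h1
    linarith [weighted_le_norm (g - p z) w]
  -- The norm limit must agree with the pointwise limits of the central value and weighted
  -- derivatives, all zero.
  have hg0 : g = 0 := norm_le_zero_iff.1 ((norm_le_add hgc hgw).trans_eq (add_zero 0))
  rw [hg0] at hg
  have h1 : Tendsto (fun z : disk => tau α φ z * ‖φ z‖) U (𝓝 0) :=
    squeeze_zero (fun z => mul_nonneg (tau_nonneg hm z) (norm_nonneg _))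
      (fun z => tau_mul_norm_le hα hφ hm h z) (tendsto_norm_zero.comp hg)
  have h2 := h1.div hφ1 one_ne_zero
  rw [zero_div] at h2
  refine h2.congr' ?_
  filter_upwards [hφ1.eventually (lt_mem_nhds one_half_lt_one)] with z hz
  exact mul_div_cancel_right₀ _ (one_half_pos.trans hz).ne'

end HarmonicBloch

theorem mainTheorem2 (α : ℝ) (hα : 0 < α) (φ : ℂ → ℂ)
    (hφ : AnalyticOnNhd ℂ φ HarmonicBloch.disk)
    (hmaps : Set.MapsTo φ HarmonicBloch.disk HarmonicBloch.disk) :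
    HarmonicBloch.CompositionCompact α φ hmaps ↔
      (BddAbove (Set.range fun z : HarmonicBloch.disk => HarmonicBloch.tau α φ z) ∧
        Tendsto (fun z : HarmonicBloch.disk => HarmonicBloch.tau α φ z)
          (comap (fun z : HarmonicBloch.disk => ‖φ z‖) (𝓝[<] 1)) (𝓝 0)) :=
  ⟨fun hc => ⟨HarmonicBloch.bddAbove_tau_of_compositionCompact hα hφ.differentiableOn hmaps hc,
      HarmonicBloch.tendsto_tau_of_compositionCompact hα hφ.differentiableOn hmaps hc⟩,
    fun hb => HarmonicBloch.compositionCompact_of_tau hα hφ.differentiableOn hmaps hb.1 hb.2⟩
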